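/- Let $d\ge 1$ and let $G\le \operatorname{O}(d)$ be a finite group of order $m$, acting on $\mathbb{R}^d$ (with its Euclidean inner product and norm). Write $[x]=G\cdot x$ for the orbit of $x\in\mathbb{R}^d$, and equip the orbit space $\mathbb{R}^d/G$ with the quotient metric $$d([x],[y])=\inf_{p\in[x],\,q\in[y]}\|p-q\|$$ and the max filtering map $$\langle\langle [x],[y]\rangle\rangle=\sup_{p\in[x],\,q\in[y]}\langle p,q\rangle .$$ For templates $z_1,\dots,z_n\in\mathbb{R}^d$, the corresponding max filter bank is the map $\Phi\colon\mathbb{R}^d/G\to\mathbb{R}^n$ given by $\Phi([x])=(\langle\langle [z_i],[x]\rangle\rangle)_{i=1}^n$. Put $$\delta:=\Big(\frac{\pi}{128m^4}\cdot\frac{1}{2d+3\log(4m^2)}\Big)^{1/2},$$ and let $n$ be an integer with $$n\ \ge\ 12\,m^2d\,\log\!\Big(\frac{2}{\delta}+1\Big),$$ where $\log$ is the natural logarithm. Let $z_1,\dots,z_n$ be independent random vectors, each uniformly distributed on the unit sphere $S^{d-1}\subset\mathbb{R}^d$. Then, with probability at least $1-e^{-n/(12m^2)}$, the max filter bank $\Phi$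 with templates $z_1,\dots,z_n$ has lower Lipschitz bound $\delta$ and upper Lipschitz bound $n^{1/2}$, that is, $$\delta\, d([x],[y])\ \le\ \|\Phi([x])-\Phi([y])\|\ \le\ n^{1/2}\, d([x],[y])\qquad\text{for all } x,y\in\mathbb{R}^d,$$ where $\|\cdot\|$ is the Euclidean norm. -/

import Mathlib

open MeasureTheory ProbabilityTheory

noncomputable section

namespace MaxFiltering

variable {V : Type*} [NormedAddCommGroup V] [InnerProductSpace ℝ V]

/-- The orbit equivalence relation on `V` of a group `G` of linear isometries of `V`. -/
def orbitSetoid (G : Subgroup (V ≃ₗᵢ[ℝ] V)) : Setoid V where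
  r x y := ∃ g ∈ G, g x = y
  iseqv :=
    { refl := fun x => ⟨1, G.one_mem, rfl⟩
      symm := by
        rintro x y ⟨g, hg, rfl⟩
        exact ⟨g⁻¹, G.inv_mem hg, g.symm_apply_apply x⟩
      trans := by
        rintro x y z ⟨g, hg, rfl⟩ ⟨h, hh, rfl⟩
        exact ⟨h * g, G.mul_mem hh hg, rfl⟩ }

/-- The quotient space `V / G` of `G`-orbits. -/
def OrbitSpace (G : Subgroup (V ≃ₗᵢ[ℝ] V)) : Type _ :=
  Quotient (orbitSetoid G)

/-- The orbit `[x]` of a vector `x`. -/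
def orbitMk (G : Subgroup (V ≃ₗᵢ[ℝ] V)) (x : V) : OrbitSpace G :=
  Quotient.mk (orbitSetoid G) x

/-- The quotient metric `d(a, b) = inf {‖p - q‖ : p ∈ a, q ∈ b}` on `V / G`. -/
def quotientDist (G : Subgroup (V ≃ₗᵢ[ℝ] V)) (a b : OrbitSpace G) : ℝ :=
  sInf {r : ℝ | ∃ p q : V, orbitMk G p = a ∧ orbitMk G q = b ∧ r = ‖p - q‖}

/-- The max filtering map `⟪⟪a, b⟫⟫ = sup {⟪p, q⟫ : p ∈ a, q ∈ b}` on `V / G`.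
The set is nonempty, and it is bounded above because `G` acts by isometries. -/
def maxFilter (G : Subgroup (V ≃ₗᵢ[ℝ] V)) (a b : OrbitSpace G) : ℝ :=
  sSup {r : ℝ | ∃ p q : V, orbitMk G p = a ∧ orbitMk G q = b ∧ r = inner ℝ p q}

/-- The max filter bank `Φ : V / G → ℝ^n` with templates `z₁, …, zₙ`,
where `ℝ^n` carries the Euclidean norm. -/
def maxFilterBank (G : Subgroup (V ≃ₗᵢ[ℝ] V)) {n : ℕ} (z : Fin n → V) (a : OrbitSpace G) :
    EuclideanSpace ℝ (Fin n) :=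
  WithLp.toLp 2 (fun i => maxFilter G (orbitMk G (z i)) a)

/-- `c` is a lower Lipschitz bound of `Φ : V / G → ℝ^n` for the quotient metric. -/
def HasLowerLipschitzBound (G : Subgroup (V ≃ₗᵢ[ℝ] V)) {n : ℕ}
    (Φ : OrbitSpace G → EuclideanSpace ℝ (Fin n)) (c : ℝ) : Prop :=
  ∀ a b : OrbitSpace G, c * quotientDist G a b ≤ ‖Φ a - Φ b‖

/-- `C` is an upper Lipschitz bound of `Φ : V / G → ℝ^n` for the quotient metric. -/
def HasUpperLipschitzBound (G : Subgroup (V ≃ₗᵢ[ℝ] V)) {n : ℕ}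
    (Φ : OrbitSpace G → EuclideanSpace ℝ (Fin n)) (C : ℝ) : Prop :=
  ∀ a b : OrbitSpace G, ‖Φ a - Φ b‖ ≤ C * quotientDist G a b

/-- The uniform distribution on the unit sphere of `ℝ^d`: the surface measure
normalised to have total mass one (a probability measure when `0 < d`). -/
def unifSphere (d : ℕ) : Measure (Metric.sphere (0 : EuclideanSpace ℝ (Fin d)) 1) :=
  ((volume : Measure (EuclideanSpace ℝ (Fin d))).toSphere Set.univ)⁻¹ •
    (volume : Measure (EuclideanSpace ℝ (Fin d))).toSphere

end MaxFiltering

end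

/-!
Replacing representatives, `⟪⟪[z], [x]⟫⟫ = max_g ⟪z, g x⟫`. This is `‖z‖`-Lipschitz in `x`, so
unit templates give the upper bound `√n`. For the lower bound fix `x, y` and record, for each
template `zᵢ`, a pair `(g, h) ∈ G × G` attaining the maxima for `x` and `y`. Some pair is recorded
by at least `n / m²` templates, and on those the two filters differ by exactly `⟪zᵢ, w⟫` with
`w = g x - h y` and `‖w‖ ≥ d([x], [y])`. So it is enough that for no unit vector `u` as many as
`n / m²` templates fall in the slab `|⟪z, u⟫| < δ`.

The uniform measure of the slab `|⟪z, u⟫| < s` of the sphere is at most `2 s √(d / π)`: pass to the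
cone over it, which lies in a cylinder, and compare the volumes of the unit balls in dimensions
`d - 1` and `d`. The choice of `δ` thus gives a slab of half-width `2 δ` measure at most
`1 / (4 m²)`. A Chernoff bound controls the number of templates in one such slab, and a union bound
over a `δ`-net of at most `(2 / δ + 1) ^ d` unit vectors controls all slabs of half-width `δ` at
once.
-/

namespace MaxFiltering

open Metric Module Set
open scoped Pointwise

section Slab

theorem Gamma_add_half_le {x : ℝ} (hx : 0 < x) :
    Real.Gamma (x + 1 / 2) ≤ √x * Real.Gamma x := by
  have hΓ : 0 ≤ Real.Gamma x := (Real.Gamma_pos_of_pos hx).le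
  calc Real.Gamma (x + 1 / 2) = Real.Gamma (1 / 2 * x + 1 / 2 * (x + 1)) := by ring_nf
    _ ≤ Real.Gamma x ^ (1 / 2 : ℝ) * Real.Gamma (x + 1) ^ (1 / 2 : ℝ) :=
      Real.Gamma_mul_add_mul_le_rpow_Gamma_mul_rpow_Gamma hx (by positivity)
        (by norm_num) (by norm_num) (by norm_num)
    _ = √(Real.Gamma x) * √(x * Real.Gamma x) := by
      rw [Real.Gamma_add_one hx.ne', ← Real.sqrt_eq_rpow, ← Real.sqrt_eq_rpow]
    _ = √x * Real.Gamma x := by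
      rw [Real.sqrt_mul hx.le, mul_left_comm, Real.mul_self_sqrt hΓ]

variable {E F : Type*}
  [NormedAddCommGroup E] [InnerProductSpace ℝ E] [FiniteDimensional ℝ E]
  [MeasurableSpace E] [BorelSpace E]
  [NormedAddCommGroup F] [InnerProductSpace ℝ F] [FiniteDimensional ℝ F]
  [MeasurableSpace F] [BorelSpace F]

variable (E) in
theorem volume_unitBall :
    volume (ball (0 : E) 1) =
      ENNReal.ofReal (√Real.pi ^ finrank ℝ E / Real.Gamma (finrank ℝ E / 2 + 1)) := by
  rcases subsingleton_or_nontrivial E with _ | _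
  · have hball : ball (0 : E) 1 = parallelepiped (stdOrthonormalBasis ℝ E) := by
      rw [Subsingleton.eq_univ_of_nonempty (nonempty_ball.2 one_pos),
        Subsingleton.eq_univ_of_nonempty ⟨0, (mem_parallelepiped_iff _ _).2 ⟨0, by simp, by simp⟩⟩]
    rw [hball, OrthonormalBasis.volume_parallelepiped]
    simp [finrank_zero_of_subsingleton]
  · simp [InnerProductSpace.volume_ball]

theorem volume_unitBall_le_of_finrank_eq_add_one (h : finrank ℝ E = finrank ℝ F + 1) :
    volume (ball (0 : F) 1) ≤
      ENNReal.ofReal √(finrank ℝ E / Real.pi) * volume (ball (0 : E) 1) := by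
  rw [volume_unitBall, volume_unitBall, ← ENNReal.ofReal_mul (Real.sqrt_nonneg _), h]
  refine ENNReal.ofReal_le_ofReal ?_
  generalize finrank ℝ F = k
  have hx : (0 : ℝ) < k / 2 + 1 := by positivity
  have hsucc : ((k + 1 : ℕ) : ℝ) / 2 + 1 = k / 2 + 1 + 1 / 2 := by push_cast; ring
  have hΓ : Real.Gamma (((k + 1 : ℕ) : ℝ) / 2 + 1) ≤ √(k + 1 : ℕ) * Real.Gamma (k / 2 + 1) := by
    rw [hsucc]
    refine (Gamma_add_half_le hx).trans ?_
    gcongr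
    push_cast
    linarith [k.cast_nonneg (α := ℝ)]
  have hΓ₀ : 0 < Real.Gamma (k / 2 + 1) := Real.Gamma_pos_of_pos hx
  have hΓ₁ : 0 < Real.Gamma (((k + 1 : ℕ) : ℝ) / 2 + 1) := Real.Gamma_pos_of_pos (by positivity)
  have hπ : 0 < √Real.pi := Real.sqrt_pos.2 Real.pi_pos
  calc √Real.pi ^ k / Real.Gamma (k / 2 + 1)
      ≤ √(k + 1 : ℕ) * √Real.pi ^ k / Real.Gamma (((k + 1 : ℕ) : ℝ) / 2 + 1) := by
        rw [div_le_div_iff₀ hΓ₀ hΓ₁]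
        nlinarith [mul_le_mul_of_nonneg_left hΓ (pow_pos hπ k).le]
    _ = √((k + 1 : ℕ) / Real.pi) *
          (√Real.pi ^ (k + 1) / Real.Gamma (((k + 1 : ℕ) : ℝ) / 2 + 1)) := by
        rw [Real.sqrt_div (by positivity), pow_succ]
        field_simp

theorem volume_norm_lt_and_norm_orthogonalProjectionOnto_lt_le (K : Submodule ℝ E) (r s : ℝ) :
    volume {x : E | ‖x‖ < r ∧ ‖K.orthogonalProjectionOnto x‖ < s} ≤
      volume (ball (0 : K) s) * volume (ball (0 : Kᗮ) r) := by
  have hsplit := (WithLp.volume_preserving_ofLp K Kᗮ).comp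
    K.orthogonalDecomposition.measurePreserving
  have hprod : MeasurableSet (ball (0 : K) s ×ˢ ball (0 : Kᗮ) r) :=
    measurableSet_ball.prod measurableSet_ball
  rw [← Measure.prod_prod, ← Measure.volume_eq_prod,
    ← hsplit.measure_preimage hprod.nullMeasurableSet]
  refine measure_mono fun x ⟨hxr, hxs⟩ => ?_
  have hx : ‖Kᗮ.orthogonalProjectionOnto x‖ < r :=
    (Kᗮ.norm_orthogonalProjectionOnto_apply_le x).trans_lt hxr
  simpa using And.intro hxs hx

theorem volume_slab_le {u : E} (hu : ‖u‖ = 1) (s : ℝ) :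
    volume {x : E | ‖x‖ < 1 ∧ |inner ℝ x u| < s} ≤
      ENNReal.ofReal (2 * s * √(finrank ℝ E / Real.pi)) * volume (ball (0 : E) 1) := by
  set K : Submodule ℝ E := ℝ ∙ u
  have hu₀ : u ≠ 0 := norm_pos_iff.1 (hu ▸ one_pos)
  have hK : finrank ℝ K = 1 := finrank_span_singleton hu₀
  have hK' : finrank ℝ E = finrank ℝ Kᗮ + 1 := by
    rw [← K.finrank_add_finrank_orthogonal, hK, add_comm]
  have hproj (x : E) : ‖K.orthogonalProjectionOnto x‖ = |inner ℝ x u| := by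
    rw [Submodule.coe_norm, Submodule.coe_orthogonalProjectionOnto_apply,
      Submodule.starProjection_unit_singleton ℝ hu, norm_smul, hu, mul_one, real_inner_comm,
      Real.norm_eq_abs]
  have hball : volume (ball (0 : K) s) = ENNReal.ofReal (2 * s) := by
    rw [InnerProductSpace.volume_ball_of_dim_odd (k := 0) (by simpa using hK), hK,
      mul_comm, ENNReal.ofReal_mul two_pos.le]
    simp
  calc volume {x : E | ‖x‖ < 1 ∧ |inner ℝ x u| < s}
      ≤ volume (ball (0 : K) s) * volume (ball (0 : Kᗮ) 1) := by
        simpa only [hproj] using volume_norm_lt_and_norm_orthogonalProjectionOnto_lt_le K 1 s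
    _ ≤ ENNReal.ofReal (2 * s) *
          (ENNReal.ofReal √(finrank ℝ E / Real.pi) * volume (ball (0 : E) 1)) := by
        rw [hball]
        gcongr
        exact volume_unitBall_le_of_finrank_eq_add_one hK'
    _ = ENNReal.ofReal (2 * s * √(finrank ℝ E / Real.pi)) * volume (ball (0 : E) 1) := by
        rw [← mul_assoc, ← ENNReal.ofReal_mul' (Real.sqrt_nonneg _)]

variable (E) in
/-- The uniform distribution on the unit sphere of `E`: the surface measure normalised to have
total mass one. It is zero when `E` is trivial, the sphere being empty. -/
noncomputable def sphereUniform : Measure (sphere (0 : E) 1) :=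
  ((volume : Measure E).toSphere univ)⁻¹ • (volume : Measure E).toSphere

theorem sphereUniform_apply {A : Set (sphere (0 : E) 1)} (hA : MeasurableSet A) :
    sphereUniform E A =
      volume (Ioo (0 : ℝ) 1 • ((↑) '' A : Set E)) / volume (ball (0 : E) 1) := by
  rcases subsingleton_or_nontrivial E with _ | _
  · have hA₀ : A = ∅ := eq_empty_of_isEmpty A
    simp [hA₀]
  · rw [sphereUniform, Measure.smul_apply, smul_eq_mul, Measure.toSphere_apply_univ,
      Measure.toSphere_apply' _ hA, ← ENNReal.div_eq_inv_mul]
    exact ENNReal.mul_div_mul_left _ _ (Nat.cast_ne_zero.2 finrank_pos.ne')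
      (ENNReal.natCast_ne_top _)

theorem measurableSet_sphere_slab (u : E) (s : ℝ) :
    MeasurableSet {z : sphere (0 : E) 1 | |inner ℝ (z : E) u| < s} :=
  measurableSet_lt (by fun_prop) measurable_const

theorem sphereUniform_slab_le {u : E} (hu : ‖u‖ = 1) (s : ℝ) :
    sphereUniform E {z | |inner ℝ (z : E) u| < s} ≤
      ENNReal.ofReal (2 * s * √(finrank ℝ E / Real.pi)) := by
  rw [sphereUniform_apply (measurableSet_sphere_slab u s)]
  refine ENNReal.div_le_of_le_mul ((measure_mono ?_).trans (volume_slab_le hu s))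
  rintro _ ⟨r, ⟨hr₀, hr₁⟩, _, ⟨z, hz, rfl⟩, rfl⟩
  have hnorm : ‖r • (z : E)‖ = r := by simp [norm_smul, abs_of_pos hr₀]
  have hinner : |inner ℝ (r • (z : E)) u| = r * |inner ℝ (z : E) u| := by
    rw [real_inner_smul_left, abs_mul, abs_of_pos hr₀]
  exact ⟨hnorm.trans_lt hr₁,
    hinner.trans_lt ((mul_le_of_le_one_left (abs_nonneg _) hr₁.le).trans_lt hz)⟩

end Slab

section Net

variable {E : Type*} [NormedAddCommGroup E] [NormedSpace ℝ E] [FiniteDimensional ℝ E]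
  {ε : NNReal} {r : ℝ} {x : E} {A : Set E}

theorem card_le_of_isSeparated_of_subset_closedBall (hε : 0 < ε) (hr : 0 ≤ r) {s : Finset E}
    (hsr : (s : Set E) ⊆ closedBall x r) (hs : IsSeparated ε (s : Set E)) :
    (s.card : ℝ) ≤ (2 * r / ε + 1) ^ finrank ℝ E := by
  borelize E
  have hε' : (0 : ℝ) < ε := hε
  let μ : Measure E := Measure.addHaar
  have hdisj : (s : Set E).PairwiseDisjoint fun c => ball c (ε / 2) := fun c hc d hd hcd =>
    ball_disjoint_ball <| by
      have hsep : (ε : ENNReal) < edist c d := hs hc hd hcd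
      rw [edist_nndist, ENNReal.coe_lt_coe, ← NNReal.coe_lt_coe, coe_nndist] at hsep
      linarith
  have hsub : (⋃ c ∈ s, ball c (ε / 2)) ⊆ ball x (ε / 2 + r) :=
    iUnion₂_subset fun c hc => ball_subset_ball' (by gcongr; exact hsr hc)
  have hμ (c : E) {ρ : ℝ} (hρ : 0 < ρ) :
      μ.real (ball c ρ) = ρ ^ finrank ℝ E * μ.real (ball 0 1) := by
    rw [measureReal_def, μ.addHaar_ball_of_pos c hρ, ENNReal.toReal_mul,
      ENNReal.toReal_ofReal (by positivity), measureReal_def]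
  have hvol : (s.card : ℝ) * (ε / 2) ^ finrank ℝ E * μ.real (ball 0 1) ≤
      (ε / 2 + r) ^ finrank ℝ E * μ.real (ball 0 1) :=
    calc (s.card : ℝ) * (ε / 2) ^ finrank ℝ E * μ.real (ball 0 1)
        = μ.real (⋃ c ∈ s, ball c (ε / 2)) := by
          rw [measureReal_biUnion_finset hdisj fun _ _ => measurableSet_ball]
          simp only [hμ _ (half_pos hε'), Finset.sum_const, nsmul_eq_mul, mul_assoc]
      _ ≤ μ.real (ball x (ε / 2 + r)) := measureReal_mono hsub
      _ = (ε / 2 + r) ^ finrank ℝ E * μ.real (ball 0 1) :=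
          hμ x (by positivity)
  have hball : 0 < μ.real (ball (0 : E) 1) :=
    ENNReal.toReal_pos (measure_ball_pos μ _ one_pos).ne' measure_ball_lt_top.ne
  calc (s.card : ℝ) ≤ (ε / 2 + r) ^ finrank ℝ E / (ε / 2) ^ finrank ℝ E := by
        rw [le_div_iff₀ (by positivity)]
        exact le_of_mul_le_mul_right hvol hball
    _ = (2 * r / ε + 1) ^ finrank ℝ E := by
        rw [← div_pow]
        congr 1
        field_simp
        ring

theorem packingNumber_le_of_subset_closedBall (hε : 0 < ε) (hr : 0 ≤ r)
    (hA : A ⊆ closedBall x r) :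
    packingNumber ε A ≤ ⌊(2 * r / ε + 1) ^ finrank ℝ E⌋₊ := by
  refine iSup₂_le fun C hCA => iSup_le fun hC => ?_
  by_contra! hcard
  obtain ⟨s, hsC, hs⟩ := exists_subset_encard_eq (Order.add_one_le_of_lt hcard)
  have hfin : s.Finite := finite_of_encard_eq_coe (by exact_mod_cast hs)
  lift s to Finset E using hfin
  have hle := Nat.le_floor <| card_le_of_isSeparated_of_subset_closedBall hε hr
    (hsC.trans (hCA.trans hA)) (hC.subset hsC)
  rw [encard_coe_eq_coe_finsetCard] at hs
  norm_cast at hs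
  omega

theorem exists_finset_isCover_card_le (hε : 0 < ε) (hr : 0 ≤ r) (hA : A ⊆ closedBall x r) :
    ∃ N : Finset E, (N : Set E) ⊆ A ∧ IsCover ε A (N : Set E) ∧
      (N.card : ℝ) ≤ (2 * r / ε + 1) ^ finrank ℝ E := by
  have hpack := packingNumber_le_of_subset_closedBall hε hr hA
  have hpack' : packingNumber ε A ≠ ⊤ := (hpack.trans_lt (ENat.natCast_lt_top _)).ne
  have hfin : (maximalSeparatedSet ε A).Finite :=
    encard_ne_top_iff.1 (encard_maximalSeparatedSet hpack' ▸ hpack')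
  obtain ⟨N, hN⟩ : ∃ N : Finset E, (N : Set E) = maximalSeparatedSet ε A :=
    ⟨hfin.toFinset, hfin.coe_toFinset⟩
  have hNA : (N : Set E) ⊆ A := hN ▸ maximalSeparatedSet_subset
  exact ⟨N, hNA, hN ▸ isCover_maximalSeparatedSet hpack',
    card_le_of_isSeparated_of_subset_closedBall hε hr (hNA.trans hA)
      (hN ▸ isSeparated_maximalSeparatedSet)⟩

end Net

section Chernoff

variable {Ω : Type*} [MeasurableSpace Ω] {P : Measure Ω}

theorem mgf_indicator_one [IsProbabilityMeasure P] {A : Set Ω} (hA : NullMeasurableSet A P)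
    (t : ℝ) : mgf (A.indicator 1) P t = 1 + P.real A * (Real.exp t - 1) := by
  have hexp : (fun ω => Real.exp (t * A.indicator 1 ω)) =
      fun ω => 1 + A.indicator (fun _ => Real.exp t - 1) ω := by
    funext ω
    by_cases hω : ω ∈ A <;> simp [hω]
  have hint : Integrable (A.indicator fun _ => Real.exp t - 1) P :=
    (integrable_const _).indicator₀ hA
  rw [mgf, hexp, integral_add (integrable_const _) hint, integral_indicator₀ hA]
  simp

theorem mgf_indicator_one_le_exp [IsProbabilityMeasure P] {A : Set Ω}
    (hA : NullMeasurableSet A P) {p t : ℝ} (hp : P.real A ≤ p) (ht : 0 ≤ t) :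
    mgf (A.indicator 1) P t ≤ Real.exp (p * (Real.exp t - 1)) := by
  have hexp : 0 ≤ Real.exp t - 1 := sub_nonneg.2 (Real.one_le_exp ht)
  calc mgf (A.indicator 1) P t = P.real A * (Real.exp t - 1) + 1 := by
        rw [mgf_indicator_one hA, add_comm]
    _ ≤ p * (Real.exp t - 1) + 1 := by gcongr
    _ ≤ Real.exp (p * (Real.exp t - 1)) := Real.add_one_le_exp _

theorem measureReal_ncard_ge_le {ι : Type*} [Fintype ι] {S : ι → Type*}
    [∀ i, MeasurableSpace (S i)] {X : ∀ i, Ω → S i} (hindep : iIndepFun X P)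
    (hX : ∀ i, AEMeasurable (X i) P) {A : ∀ i, Set (S i)} (hA : ∀ i, MeasurableSet (A i))
    {p : ι → ℝ} (hp : ∀ i, P.real (X i ⁻¹' A i) ≤ p i) {t : ℝ} (ht : 0 ≤ t) (r : ℝ) :
    P.real {ω | r ≤ ({i | X i ω ∈ A i}.ncard : ℝ)} ≤
      Real.exp ((∑ i, p i) * (Real.exp t - 1) - t * r) := by
  classical
  have := hindep.isProbabilityMeasure
  let Y (i : ι) : Ω → ℝ := (X i ⁻¹' A i).indicator 1
  have hnull (i : ι) : NullMeasurableSet (X i ⁻¹' A i) P := (hX i).nullMeasurable (hA i)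
  have hY (i : ι) : AEMeasurable (Y i) P := aemeasurable_const.indicator₀ (hnull i)
  have hYindep : iIndepFun Y P :=
    hindep.comp (fun i => (A i).indicator 1) fun i => measurable_const.indicator (hA i)
  have hcount (ω : Ω) : (∑ i, Y i) ω = ({i | X i ω ∈ A i}.ncard : ℝ) := by
    simp [Y, indicator_apply, ncard_eq_toFinset_card', Finset.sum_boole]
  have hint : Integrable (fun ω => Real.exp (t * (∑ i, Y i) ω)) P :=
    integrable_exp_mul_of_le t (Nat.card ι) ht (Finset.aemeasurable_sum _ fun i _ => hY i) <|
      ae_of_all _ fun ω => by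
        rw [hcount]
        exact_mod_cast ncard_le_card _
  calc P.real {ω | r ≤ ({i | X i ω ∈ A i}.ncard : ℝ)}
      = P.real {ω | r ≤ (∑ i, Y i) ω} := by simp only [hcount]
    _ ≤ Real.exp (-t * r) * mgf (∑ i, Y i) P t := measure_ge_le_exp_mul_mgf r ht hint
    _ = Real.exp (-t * r) * ∏ i, mgf (Y i) P t := by rw [hYindep.mgf_sum₀ hY]
    _ ≤ Real.exp (-t * r) * ∏ i, Real.exp (p i * (Real.exp t - 1)) := by
        gcongr with i
        exacts [fun _ _ => mgf_nonneg, mgf_indicator_one_le_exp (hnull i) (hp i) ht]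
    _ = Real.exp ((∑ i, p i) * (Real.exp t - 1) - t * r) := by
        rw [← Real.exp_sum, ← Finset.sum_mul, ← Real.exp_add]
        congr 1
        ring

end Chernoff

section UnionBound

variable {E : Type*} [NormedAddCommGroup E] [InnerProductSpace ℝ E] {δ : ℝ}

theorem abs_inner_lt_two_mul {z u v : E} (hz : ‖z‖ ≤ 1) (huv : ‖u - v‖ ≤ δ)
    (hu : |inner ℝ z u| < δ) : |inner ℝ z v| < 2 * δ :=
  calc |inner ℝ z v| = |inner ℝ z u - inner ℝ z (u - v)| := by rw [inner_sub_right, sub_sub_cancel]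
    _ ≤ |inner ℝ z u| + |inner ℝ z (u - v)| := abs_sub _ _
    _ ≤ |inner ℝ z u| + 1 * δ := by
      gcongr
      exact (abs_real_inner_le_norm _ _).trans (by gcongr)
    _ < 2 * δ := by linarith

variable [FiniteDimensional ℝ E] [MeasurableSpace E] [BorelSpace E]
  {ι Ω : Type*} [Fintype ι] [MeasurableSpace Ω] {P : Measure Ω} {z : ι → Ω → E} {p : ℝ}

theorem measureReal_exists_ncard_slab_ge_le (hindep : iIndepFun z P)
    (hz : ∀ i, AEMeasurable (z i) P) (hnorm : ∀ i ω, ‖z i ω‖ ≤ 1) (hδ : 0 < δ)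
    (hp : ∀ i (u : E), ‖u‖ = 1 → P.real {ω | |inner ℝ (z i ω) u| < 2 * δ} ≤ p)
    {t : ℝ} (ht : 0 ≤ t) (r : ℝ) :
    P.real {ω | ∃ u : E, ‖u‖ = 1 ∧ r ≤ ({i | |inner ℝ (z i ω) u| < δ}.ncard : ℝ)} ≤
      (2 / δ + 1) ^ finrank ℝ E *
        Real.exp (Fintype.card ι * p * (Real.exp t - 1) - t * r) := by
  have := hindep.isProbabilityMeasure
  lift δ to NNReal using hδ.le
  obtain ⟨N, hNsphere, hNcover, hNcard⟩ :=
    exists_finset_isCover_card_le (A := sphere (0 : E) 1) hδ zero_le_one sphere_subset_closedBall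
  let B (c : E) : Set Ω := {ω | r ≤ ({i | |inner ℝ (z i ω) c| < 2 * δ}.ncard : ℝ)}
  have hslab (c : E) : MeasurableSet {x : E | |inner ℝ x c| < 2 * δ} :=
    measurableSet_lt (by fun_prop) measurable_const
  have hB (c : E) (hc : c ∈ N) :
      P.real (B c) ≤ Real.exp (Fintype.card ι * p * (Real.exp t - 1) - t * r) := by
    simpa using measureReal_ncard_ge_le hindep hz (fun _ => hslab c)
      (fun i => hp i c (mem_sphere_zero_iff_norm.1 (hNsphere hc))) ht r
  have hsub : {ω | ∃ u : E, ‖u‖ = 1 ∧ r ≤ ({i | |inner ℝ (z i ω) u| < δ}.ncard : ℝ)} ⊆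
      ⋃ c ∈ N, B c := by
    rintro ω ⟨u, hu, hr⟩
    obtain ⟨c, hc, huc⟩ := mem_iUnion₂.1 <|
      isCover_iff_subset_iUnion_closedBall.1 hNcover (mem_sphere_zero_iff_norm.2 hu)
    refine mem_iUnion₂.2 ⟨c, hc, hr.trans (Nat.cast_le.2 (ncard_le_ncard fun i hi => ?_))⟩
    exact abs_inner_lt_two_mul (hnorm i ω) (mem_closedBall_iff_norm.1 huc) hi
  calc P.real {ω | ∃ u : E, ‖u‖ = 1 ∧ r ≤ ({i | |inner ℝ (z i ω) u| < δ}.ncard : ℝ)}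
      ≤ P.real (⋃ c ∈ N, B c) := measureReal_mono hsub (measure_ne_top _ _)
    _ ≤ ∑ c ∈ N, P.real (B c) := measureReal_biUnion_finset_le N B
    _ ≤ N.card * Real.exp (Fintype.card ι * p * (Real.exp t - 1) - t * r) := by
        rw [← nsmul_eq_mul]
        exact Finset.sum_le_card_nsmul _ _ _ hB
    _ ≤ (2 / δ + 1) ^ finrank ℝ E *
          Real.exp (Fintype.card ι * p * (Real.exp t - 1) - t * r) := by
        gcongr
        simpa using hNcard

theorem measureReal_exists_ncard_slab_ge_le_exp_neg (hindep : iIndepFun z P)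
    (hz : ∀ i, AEMeasurable (z i) P) (hnorm : ∀ i ω, ‖z i ω‖ ≤ 1) (hδ : 0 < δ) {M : ℝ}
    (hM : 0 < M)
    (hp : ∀ i (u : E), ‖u‖ = 1 → P.real {ω | |inner ℝ (z i ω) u| < 2 * δ} ≤ 1 / (4 * M))
    (hcard : 12 * M * finrank ℝ E * Real.log (2 / δ + 1) ≤ Fintype.card ι) :
    P.real {ω | ∃ u : E, ‖u‖ = 1 ∧
        Fintype.card ι / M ≤ ({i | |inner ℝ (z i ω) u| < δ}.ncard : ℝ)} ≤
      Real.exp (-Fintype.card ι / (12 * M)) := by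
  generalize hn : (Fintype.card ι : ℝ) = n at hcard ⊢
  have hn₀ : 0 ≤ n := hn ▸ Nat.cast_nonneg _
  have hnet : (2 / δ + 1) ^ finrank ℝ E ≤ Real.exp (n / (12 * M)) := by
    rw [← Real.log_le_iff_le_exp (by positivity), Real.log_pow, le_div_iff₀ (by positivity)]
    linarith
  have hchernoff : n * (1 / (4 * M)) * (Real.exp 1 - 1) - 1 * (n / M) ≤ -(n / (6 * M)) :=
    calc n * (1 / (4 * M)) * (Real.exp 1 - 1) - 1 * (n / M)
        = n / M * ((Real.exp 1 - 1) / 4 - 1) := by field_simp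
      _ ≤ n / M * (-(1 / 6)) := by gcongr; linarith [Real.exp_one_lt_d9]
      _ = -(n / (6 * M)) := by field_simp
  calc _ ≤ (2 / δ + 1) ^ finrank ℝ E *
        Real.exp (n * (1 / (4 * M)) * (Real.exp 1 - 1) - 1 * (n / M)) :=
        hn ▸ measureReal_exists_ncard_slab_ge_le hindep hz hnorm hδ hp zero_le_one _
    _ ≤ Real.exp (n / (12 * M)) * Real.exp (-(n / (6 * M))) := by gcongr
    _ = Real.exp (-n / (12 * M)) := by
        rw [← Real.exp_add]
        congr 1
        field_simp
        ring

end UnionBound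

section MaxFilter

variable {V : Type*} [NormedAddCommGroup V] [InnerProductSpace ℝ V]
  {G : Subgroup (V ≃ₗᵢ[ℝ] V)}

theorem orbitMk_eq_iff {x y : V} : orbitMk G x = orbitMk G y ↔ ∃ g ∈ G, g x = y :=
  Quotient.eq (r := orbitSetoid G)

theorem orbitMk_apply (g : G) (x : V) : orbitMk G (g.1 x) = orbitMk G x :=
  (orbitMk_eq_iff.2 ⟨g.1, g.2, rfl⟩).symm

theorem orbitMk_surjective : Function.Surjective (orbitMk G) :=
  Quotient.mk_surjective

theorem quotientDist_mk_le (g h : G) (x y : V) :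
    quotientDist G (orbitMk G x) (orbitMk G y) ≤ ‖g.1 x - h.1 y‖ := by
  refine csInf_le ⟨0, ?_⟩ ⟨_, _, orbitMk_apply g x, orbitMk_apply h y, rfl⟩
  rintro _ ⟨p, q, -, -, rfl⟩
  exact norm_nonneg _

theorem hasUpperLipschitzBound_of_norm_mk_sub_mk_le {n : ℕ}
    {Φ : OrbitSpace G → EuclideanSpace ℝ (Fin n)} {C : ℝ} (hC : 0 ≤ C)
    (h : ∀ x y : V, ‖Φ (orbitMk G x) - Φ (orbitMk G y)‖ ≤ C * ‖x - y‖) :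
    HasUpperLipschitzBound G Φ C := by
  intro a b
  obtain ⟨x, rfl⟩ := orbitMk_surjective a
  obtain ⟨y, rfl⟩ := orbitMk_surjective b
  rcases hC.eq_or_lt with rfl | hC
  · simpa using h x y
  rw [← div_le_iff₀' hC]
  refine le_csInf ⟨_, x, y, rfl, rfl, rfl⟩ ?_
  rintro _ ⟨p, q, hp, hq, rfl⟩
  rw [div_le_iff₀' hC, ← hp, ← hq]
  exact h p q

theorem maxFilter_comm (a b : OrbitSpace G) : maxFilter G a b = maxFilter G b a := by
  simp only [maxFilter]
  congr 1
  ext r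
  constructor <;> rintro ⟨p, q, hp, hq, rfl⟩ <;> exact ⟨q, p, hq, hp, real_inner_comm _ _⟩

theorem maxFilter_mk (z x : V) :
    maxFilter G (orbitMk G z) (orbitMk G x) = ⨆ g : G, inner ℝ z (g.1 x) := by
  rw [maxFilter, iSup]
  congr 1
  ext r
  constructor
  · rintro ⟨p, q, hp, hq, rfl⟩
    obtain ⟨g, hg, rfl⟩ := orbitMk_eq_iff.1 hp.symm
    obtain ⟨h, hh, rfl⟩ := orbitMk_eq_iff.1 hq.symm
    exact ⟨⟨g⁻¹ * h, G.mul_mem (G.inv_mem hg) hh⟩, (g.inner_map_eq_flip z (h x)).symm⟩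
  · rintro ⟨g, rfl⟩
    exact ⟨z, g.1 x, rfl, orbitMk_apply g x, rfl⟩

theorem inner_le_maxFilter (g : G) (z x : V) :
    inner ℝ z (g.1 x) ≤ maxFilter G (orbitMk G z) (orbitMk G x) := by
  rw [maxFilter_mk]
  refine le_ciSup (f := fun g : G => inner ℝ z (g.1 x)) ⟨‖z‖ * ‖x‖, ?_⟩ g
  rintro _ ⟨h, rfl⟩
  simpa using real_inner_le_norm z (h.1 x)

theorem maxFilter_le_add (z x y : V) :
    maxFilter G (orbitMk G z) (orbitMk G x) ≤
      maxFilter G (orbitMk G z) (orbitMk G y) + ‖z‖ * ‖x - y‖ := by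
  rw [maxFilter_mk z x]
  refine ciSup_le fun g => ?_
  calc inner ℝ z (g.1 x) = inner ℝ z (g.1 y) + inner ℝ z (g.1 (x - y)) := by
        rw [← inner_add_right, ← map_add, add_sub_cancel]
    _ ≤ maxFilter G (orbitMk G z) (orbitMk G y) + ‖z‖ * ‖x - y‖ := by
        gcongr
        · exact inner_le_maxFilter g z y
        · exact (real_inner_le_norm z (g.1 (x - y))).trans_eq (by rw [LinearIsometryEquiv.norm_map])

theorem abs_maxFilter_sub_le (z x y : V) :
    |maxFilter G (orbitMk G z) (orbitMk G x) - maxFilter G (orbitMk G z) (orbitMk G y)| ≤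
      ‖z‖ * ‖x - y‖ :=
  abs_sub_le_iff.2 ⟨sub_left_le_of_le_add (maxFilter_le_add z x y),
    sub_left_le_of_le_add (norm_sub_rev x y ▸ maxFilter_le_add z y x)⟩

theorem continuous_maxFilter_mk (a : OrbitSpace G) :
    Continuous fun z : V => maxFilter G (orbitMk G z) a := by
  obtain ⟨x, rfl⟩ := orbitMk_surjective a
  refine (LipschitzWith.of_dist_le_mul (K := ‖x‖₊) fun y z => ?_).continuous
  rw [maxFilter_comm, maxFilter_comm _ (orbitMk G x), Real.dist_eq, dist_eq_norm]
  exact abs_maxFilter_sub_le x y z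

variable {n : ℕ}

theorem hasUpperLipschitzBound_maxFilterBank {z : Fin n → V} (hz : ∀ i, ‖z i‖ ≤ 1) :
    HasUpperLipschitzBound G (maxFilterBank G z) √n :=
  hasUpperLipschitzBound_of_norm_mk_sub_mk_le (Real.sqrt_nonneg _) fun x y => by
    rw [EuclideanSpace.norm_eq, ← Real.sqrt_sq (norm_nonneg (x - y)),
      ← Real.sqrt_mul (Nat.cast_nonneg n)]
    refine Real.sqrt_le_sqrt ?_
    have hcoord (i : Fin n) :
        ‖(maxFilterBank G z (orbitMk G x) - maxFilterBank G z (orbitMk G y)) i‖ ^ 2 ≤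
          ‖x - y‖ ^ 2 := by
      gcongr
      exact (abs_maxFilter_sub_le (z i) x y).trans (mul_le_of_le_one_left (norm_nonneg _) (hz i))
    simpa using Finset.sum_le_card_nsmul Finset.univ _ _ fun i _ => hcoord i

theorem continuous_maxFilterBank (a : OrbitSpace G) :
    Continuous fun z : Fin n → V => maxFilterBank G z a :=
  (PiLp.continuous_toLp 2 _).comp <|
    continuous_pi fun i => (continuous_maxFilter_mk a).comp (continuous_apply i)

theorem isClosed_setOf_hasLowerLipschitzBound_maxFilterBank (δ : ℝ) :
    IsClosed {z : Fin n → V | HasLowerLipschitzBound G (maxFilterBank G z) δ} := by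
  simp only [HasLowerLipschitzBound, ofPred_forall]
  exact isClosed_iInter fun a => isClosed_iInter fun b => isClosed_le continuous_const
    ((continuous_maxFilterBank a).sub (continuous_maxFilterBank b)).norm

variable [Finite G]

theorem exists_maxFilter_eq_inner (z x : V) :
    ∃ g : G, maxFilter G (orbitMk G z) (orbitMk G x) = inner ℝ z (g.1 x) := by
  obtain ⟨g, hg⟩ := exists_eq_ciSup_of_finite (f := fun g : G => inner ℝ z (g.1 x))
  exact ⟨g, by rw [maxFilter_mk, hg]⟩

theorem exists_card_div_le_ncard_maxFilter_sub_eq (z : Fin n → V) (x y : V) :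
    ∃ g h : G, n / (Nat.card G : ℝ) ^ 2 ≤
      ({i | maxFilter G (orbitMk G (z i)) (orbitMk G x) -
          maxFilter G (orbitMk G (z i)) (orbitMk G y) =
        inner ℝ (z i) (g.1 x - h.1 y)}.ncard : ℝ) := by
  classical
  have := Fintype.ofFinite G
  choose g hg using fun i => exists_maxFilter_eq_inner (G := G) (z i) x
  choose h hh using fun i => exists_maxFilter_eq_inner (G := G) (z i) y
  have hcard : Fintype.card (G × G) • (n / (Nat.card G : ℝ) ^ 2) ≤ Fintype.card (Fin n) := by
    have hG : (Nat.card G : ℝ) ≠ 0 := Nat.cast_ne_zero.2 Nat.card_pos.ne'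
    rw [← Nat.card_eq_fintype_card, Nat.card_prod, Fintype.card_fin, nsmul_eq_mul, Nat.cast_mul,
      ← sq, mul_div_cancel₀ _ (pow_ne_zero 2 hG)]
  obtain ⟨⟨g₀, h₀⟩, hfiber⟩ :=
    Fintype.exists_le_card_fiber_of_nsmul_le_card (fun i => (g i, h i)) hcard
  refine ⟨g₀, h₀, hfiber.trans ?_⟩
  rw [← ncard_coe_finset]
  refine Nat.cast_le.2 (ncard_le_ncard fun i hi => ?_)
  obtain ⟨rfl, rfl⟩ : g i = g₀ ∧ h i = h₀ := by simpa using hi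
  rw [mem_ofPred_eq, hg, hh, inner_sub_right]

theorem hasLowerLipschitzBound_maxFilterBank {z : Fin n → V} {δ : ℝ} (hδ : 0 ≤ δ)
    (h : ∀ u : V, ‖u‖ = 1 →
      ({i | |inner ℝ (z i) u| < δ}.ncard : ℝ) < n / (Nat.card G : ℝ) ^ 2) :
    HasLowerLipschitzBound G (maxFilterBank G z) δ := by
  intro a b
  obtain ⟨x, rfl⟩ := orbitMk_surjective a
  obtain ⟨y, rfl⟩ := orbitMk_surjective b
  obtain ⟨g, k, hfiber⟩ := exists_card_div_le_ncard_maxFilter_sub_eq (G := G) z x y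
  set w := g.1 x - k.1 y
  have hdist : quotientDist G (orbitMk G x) (orbitMk G y) ≤ ‖w‖ := quotientDist_mk_le g k x y
  rcases eq_or_ne w 0 with hw | hw
  · rw [hw, norm_zero] at hdist
    exact (mul_nonpos_of_nonneg_of_nonpos hδ hdist).trans (norm_nonneg _)
  obtain ⟨i, hi, hδi⟩ : ∃ i, maxFilter G (orbitMk G (z i)) (orbitMk G x) -
      maxFilter G (orbitMk G (z i)) (orbitMk G y) = inner ℝ (z i) w ∧
      δ ≤ |inner ℝ (z i) (‖w‖⁻¹ • w)| := by
    have hlt := (h (‖w‖⁻¹ • w) (norm_smul_inv_norm hw)).trans_le hfiber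
    obtain ⟨i, hi, hi'⟩ := exists_mem_notMem_of_ncard_lt_ncard (Nat.cast_lt.1 hlt)
    exact ⟨i, hi, not_lt.1 hi'⟩
  calc δ * quotientDist G (orbitMk G x) (orbitMk G y)
      ≤ δ * ‖w‖ := by gcongr
    _ ≤ |inner ℝ (z i) (‖w‖⁻¹ • w)| * ‖w‖ := by gcongr
    _ = |inner ℝ (z i) w| := by
        rw [inner_smul_right, abs_mul, abs_inv, abs_norm, mul_right_comm,
          inv_mul_cancel₀ (norm_ne_zero_iff.2 hw), one_mul]
    _ = ‖(maxFilterBank G z (orbitMk G x) - maxFilterBank G z (orbitMk G y)) i‖ :=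
        congrArg abs hi.symm
    _ ≤ ‖maxFilterBank G z (orbitMk G x) - maxFilterBank G z (orbitMk G y)‖ :=
        PiLp.norm_apply_le _ i

end MaxFilter

section RandomTemplates

variable {E : Type*} [NormedAddCommGroup E] [InnerProductSpace ℝ E] [FiniteDimensional ℝ E]
  [MeasurableSpace E] [BorelSpace E] {G : Subgroup (E ≃ₗᵢ[ℝ] E)}
  {Ω : Type*} [MeasurableSpace Ω] {P : Measure Ω} {δ : ℝ}

theorem measureReal_slab_le {z : Ω → sphere (0 : E) 1} (hz : HasLaw z (sphereUniform E) P) {u : E}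
    (hu : ‖u‖ = 1) {s : ℝ} (hs : 0 ≤ s) :
    P.real {ω | |inner ℝ (z ω : E) u| < s} ≤ 2 * s * √(finrank ℝ E / Real.pi) := by
  have hmap := map_measureReal_apply_of_aemeasurable hz.aemeasurable (measurableSet_sphere_slab u s)
  rw [hz.map_eq] at hmap
  exact hmap.symm.trans_le <|
    ENNReal.toReal_le_of_le_ofReal (by positivity) (sphereUniform_slab_le hu s)

theorem two_mul_two_mul_mul_sqrt_div_pi_le {d M : ℝ} (hM : 0 < M) (hδ : 0 ≤ δ)
    (h : 256 * M ^ 2 * d * δ ^ 2 ≤ Real.pi) :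
    2 * (2 * δ) * √(d / Real.pi) ≤ 1 / (4 * M) := by
  rw [le_div_iff₀ (by positivity)]
  calc 2 * (2 * δ) * √(d / Real.pi) * (4 * M)
      = √((16 * M * δ) ^ 2 * (d / Real.pi)) := by
        rw [Real.sqrt_mul (sq_nonneg _), Real.sqrt_sq (by positivity)]
        ring
    _ ≤ √1 := by
        gcongr
        rw [← mul_div_assoc, div_le_one Real.pi_pos]
        linarith
    _ = 1 := Real.sqrt_one

variable {n : ℕ} {z : Fin n → Ω → E}

theorem nullMeasurableSet_hasLowerLipschitzBound_maxFilterBank (hz : ∀ i, AEMeasurable (z i) P)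
    (δ : ℝ) :
    NullMeasurableSet {ω | HasLowerLipschitzBound G (maxFilterBank G fun i => z i ω) δ} P :=
  (aemeasurable_pi_lambda (fun ω i => z i ω) hz).nullMeasurable
    (isClosed_setOf_hasLowerLipschitzBound_maxFilterBank δ).measurableSet

theorem one_sub_exp_le_measureReal_hasLowerLipschitzBound [Finite G] (hindep : iIndepFun z P)
    (hz : ∀ i, AEMeasurable (z i) P) (hnorm : ∀ i ω, ‖z i ω‖ ≤ 1) (hδ : 0 < δ)
    (hp : ∀ i (u : E), ‖u‖ = 1 →
      P.real {ω | |inner ℝ (z i ω) u| < 2 * δ} ≤ 1 / (4 * (Nat.card G : ℝ) ^ 2))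
    (hn : 12 * (Nat.card G : ℝ) ^ 2 * finrank ℝ E * Real.log (2 / δ + 1) ≤ n) :
    1 - Real.exp (-n / (12 * (Nat.card G : ℝ) ^ 2)) ≤
      P.real {ω | HasLowerLipschitzBound G (maxFilterBank G fun i => z i ω) δ} := by
  have := hindep.isProbabilityMeasure
  have hG : (0 : ℝ) < (Nat.card G : ℝ) ^ 2 := pow_pos (Nat.cast_pos.2 Nat.card_pos) 2
  have hbad := measureReal_exists_ncard_slab_ge_le_exp_neg hindep hz hnorm hδ hG hp
    (by rwa [Fintype.card_fin])
  rw [Fintype.card_fin] at hbad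
  have hsub : {ω | HasLowerLipschitzBound G (maxFilterBank G fun i => z i ω) δ}ᶜ ⊆
      {ω | ∃ u : E, ‖u‖ = 1 ∧
        n / (Nat.card G : ℝ) ^ 2 ≤ ({i | |inner ℝ (z i ω) u| < δ}.ncard : ℝ)} := by
    intro ω hω
    by_contra! hfew
    exact hω (hasLowerLipschitzBound_maxFilterBank hδ.le (by simpa using hfew))
  have hcompl := probReal_compl_eq_one_sub₀ <|
    nullMeasurableSet_hasLowerLipschitzBound_maxFilterBank (G := G) hz δ
  linarith [measureReal_mono (μ := P) hsub (measure_ne_top _ _)]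

end RandomTemplates

section Constant

/-- The lower Lipschitz constant `δ` guaranteed by the theorem for a group of order `m` acting on a
space of dimension `d`. -/
noncomputable def lowerLipschitzConstant (d m : ℕ) : ℝ :=
  √(Real.pi / (128 * (m : ℝ) ^ 4) * (1 / (2 * (d : ℝ) + 3 * Real.log (4 * (m : ℝ) ^ 2))))

variable {m : ℕ}

theorem log_four_mul_sq_pos (hm : 0 < m) : 0 < Real.log (4 * (m : ℝ) ^ 2) := by
  have hm₁ : (1 : ℝ) ≤ m := Nat.one_le_cast.2 hm
  exact Real.log_pos (by nlinarith)

theorem lowerLipschitzConstant_pos (d : ℕ) (hm : 0 < m) : 0 < lowerLipschitzConstant d m := by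
  have hlog := log_four_mul_sq_pos hm
  unfold lowerLipschitzConstant
  positivity

theorem mul_lowerLipschitzConstant_sq_le_pi (d : ℕ) (hm : 0 < m) :
    256 * (m : ℝ) ^ 4 * d * lowerLipschitzConstant d m ^ 2 ≤ Real.pi := by
  have hlog := log_four_mul_sq_pos hm
  have hL : 0 < 2 * (d : ℝ) + 3 * Real.log (4 * (m : ℝ) ^ 2) := by positivity
  calc 256 * (m : ℝ) ^ 4 * d * lowerLipschitzConstant d m ^ 2
      = Real.pi * (2 * d / (2 * d + 3 * Real.log (4 * (m : ℝ) ^ 2))) := by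
        rw [lowerLipschitzConstant, Real.sq_sqrt (by positivity)]
        field_simp
        ring
    _ ≤ Real.pi := mul_le_of_le_one_right Real.pi_pos.le <| by
        rw [div_le_one hL]
        linarith

end Constant

end MaxFiltering

theorem mainTheorem1_general {E : Type*} [NormedAddCommGroup E] [InnerProductSpace ℝ E]
    [FiniteDimensional ℝ E] [MeasurableSpace E] [BorelSpace E]
    (G : Subgroup (E ≃ₗᵢ[ℝ] E)) [Finite G] {δ : ℝ} (hδ : 0 < δ)
    (hδG : 256 * (Nat.card G : ℝ) ^ 4 * Module.finrank ℝ E * δ ^ 2 ≤ Real.pi) {n : ℕ}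
    (hn : 12 * (Nat.card G : ℝ) ^ 2 * Module.finrank ℝ E * Real.log (2 / δ + 1) ≤ n)
    {Ω : Type*} [MeasurableSpace Ω] {P : Measure Ω}
    {z : Fin n → Ω → Metric.sphere (0 : E) 1} (hindep : iIndepFun z P)
    (hlaw : ∀ i, HasLaw (z i) (MaxFiltering.sphereUniform E) P) :
    NullMeasurableSet {ω |
      MaxFiltering.HasLowerLipschitzBound G
        (MaxFiltering.maxFilterBank G fun i => (z i ω : E)) δ ∧
      MaxFiltering.HasUpperLipschitzBound G
        (MaxFiltering.maxFilterBank G fun i => (z i ω : E)) √n} P ∧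
    1 - Real.exp (-n / (12 * (Nat.card G : ℝ) ^ 2)) ≤
      P.real {ω |
        MaxFiltering.HasLowerLipschitzBound G
          (MaxFiltering.maxFilterBank G fun i => (z i ω : E)) δ ∧
        MaxFiltering.HasUpperLipschitzBound G
          (MaxFiltering.maxFilterBank G fun i => (z i ω : E)) √n} := by
  have hnorm (i : Fin n) (ω : Ω) : ‖(z i ω : E)‖ ≤ 1 := (norm_eq_of_mem_sphere _).le
  have hmeas (i : Fin n) : AEMeasurable (fun ω => (z i ω : E)) P :=
    measurable_subtype_coe.comp_aemeasurable (hlaw i).aemeasurable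
  have hG : (0 : ℝ) < (Nat.card G : ℝ) ^ 2 := pow_pos (Nat.cast_pos.2 Nat.card_pos) 2
  have hslab (i : Fin n) (u : E) (hu : ‖u‖ = 1) :
      P.real {ω | |inner ℝ (z i ω : E) u| < 2 * δ} ≤ 1 / (4 * (Nat.card G : ℝ) ^ 2) :=
    (MaxFiltering.measureReal_slab_le (hlaw i) hu (by positivity)).trans <|
      MaxFiltering.two_mul_two_mul_mul_sqrt_div_pi_le hG hδ.le (by rwa [← pow_mul])
  simp only [MaxFiltering.hasUpperLipschitzBound_maxFilterBank (hnorm · _), and_true]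
  exact ⟨MaxFiltering.nullMeasurableSet_hasLowerLipschitzBound_maxFilterBank hmeas δ,
    MaxFiltering.one_sub_exp_le_measureReal_hasLowerLipschitzBound
      (hindep.comp (fun _ => Subtype.val) fun _ => measurable_subtype_coe)
      hmeas hnorm hδ hslab hn⟩

theorem mainTheorem1 (d m n : ℕ) (hd : 0 < d)
    (G : Subgroup (EuclideanSpace ℝ (Fin d) ≃ₗᵢ[ℝ] EuclideanSpace ℝ (Fin d)))
    [Finite G] (hm : Nat.card G = m)
    (δ : ℝ)
    (hδ : δ = Real.sqrt (Real.pi / (128 * (m : ℝ) ^ 4) *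
      (1 / (2 * (d : ℝ) + 3 * Real.log (4 * (m : ℝ) ^ 2)))))
    (hn : 12 * (m : ℝ) ^ 2 * (d : ℝ) * Real.log (2 / δ + 1) ≤ (n : ℝ))
    {Ω : Type*} [MeasurableSpace Ω] (P : Measure Ω) [IsProbabilityMeasure P]
    (z : Fin n → Ω → Metric.sphere (0 : EuclideanSpace ℝ (Fin d)) 1)
    (hindep : iIndepFun z P)
    (hlaw : ∀ i, HasLaw (z i) (MaxFiltering.unifSphere d) P) :
    NullMeasurableSet {ω | MaxFiltering.HasLowerLipschitzBound G
        (MaxFiltering.maxFilterBank G (fun i => (z i ω : EuclideanSpace ℝ (Fin d)))) δ ∧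
      MaxFiltering.HasUpperLipschitzBound G
        (MaxFiltering.maxFilterBank G (fun i => (z i ω : EuclideanSpace ℝ (Fin d))))
        (Real.sqrt n)} P ∧
    1 - Real.exp (-(n : ℝ) / (12 * (m : ℝ) ^ 2)) ≤
      P.real {ω | MaxFiltering.HasLowerLipschitzBound G
          (MaxFiltering.maxFilterBank G (fun i => (z i ω : EuclideanSpace ℝ (Fin d)))) δ ∧
        MaxFiltering.HasUpperLipschitzBound G
          (MaxFiltering.maxFilterBank G (fun i => (z i ω : EuclideanSpace ℝ (Fin d))))
          (Real.sqrt n)} := by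
  have hm₀ : 0 < m := hm ▸ Nat.card_pos
  subst hδ hm
  exact mainTheorem1_general G (MaxFiltering.lowerLipschitzConstant_pos d hm₀)
    (by simpa using MaxFiltering.mul_lowerLipschitzConstant_sq_le_pi d hm₀)
    (by rwa [finrank_euclideanSpace_fin]) hindep hlaw
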